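/- \textbf{Definitions.} Let $d\ge 2$. For $i\in\mathbb N$ let $S_i\subset\mathbb R^d$ be the $(d-1)$-sphere of radius $1$ with center $(3i,0,\dots,0)$; fix an orientation of $S_0$ and orient $S_i$ so that the translation $S_0\to S_i$ preserves orientation. Put $\underline n=S_0\cup\dots\cup S_{n-1}$ (so $\underline 0=\emptyset$). A $d$-cobordism $K:\underline n\to\underline m$ is a triple $(M,f_0,f_1)$, where $M$ is a compact oriented $d$-dimensional topological manifold with boundary, and $f_0:\underline n\to M$, $f_1:\underline m\to M$ are embeddings with disjoint images whose union is $\partial M$, such that $f_0$ preserves and $f_1$ reverses orientation with respect to the orientation of $\partial M$ induced by that of $M$ (a positively oriented chart of $M$ into $\{x_d\ge 0\}$ restricts to a positively oriented chart of $\partial M$). Two cobordisms $(M,f_0,f_1)$ and $(M',f_0',f_1')$ from $\underline n$ to $\underline m$ are equivalent when there is an orientation preserving homeomorphism $F:M\to M'$ with $F\circ f_0=f_0'$ and $F\circ f_1=f_1'$. The category $dCobS$ has the objects $\underline 0,\underline 1,\underline 2,\dots$, and its arrows are the equivalence classes of $d$-cobordisms. The identity of $\underline n$ is the class of the cylinder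 $\underline n\times[0,1]$ with the product orientation and its two ends $x\mapsto(x,0)$, $x\mapsto(x,1)$. The composition of the classes of $(M,f_0,f_1):\underline n\to\underline m$ and $(N,g_0,g_1):\underline m\to\underline k$ is the class of the space obtained from $N\sqcup M$ by identifying $g_0(z)$ with $f_1(z)$ for $z\in\underline m$, oriented so that the embeddings of the interiors of $M$ and $N$ preserve orientation, together with the maps induced by $f_0$ and $g_1$. Let $\mathbf K$ be the category with the natural numbers as objects whose arrows are the terms built by composition $\circ$ and tensor $\otimes$ (which is addition on objects) from $1_n:n\to n$, $\tau_{n,m}:n+m\to m+n$, $\mu:2\to1$, $\eta:0\to1$, $\delta:1\to2$, $\varepsilon:1\to0$, modulo the smallest congruence that makes $\mathbf K$ a symmetric strict monoidal category with symmetry $\tau$ and $(1,\mu,\eta,\delta,\varepsilon)$ a commutative Frobenius object in it. A category is skeletal when no two different objects of it are isomorphic. \textbf{Statement.} For every $d\ge 2$, if the class of a $d$-cobordism $K:\underline n\to\underline m$ is an isomorphism in $dCobS$, then $n=m$. Consequently, the categories $dCobS$, for $d\ge2$, and $\mathbf K$ are skeletal. -/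

import Mathlib

open CategoryTheory CategoryTheory.Limits

noncomputable section

/-! ### Local homology and orientation of topological manifolds -/

/-- Euclidean space `ℝⁿ`. -/
abbrev Euc (n : ℕ) : Type := EuclideanSpace ℝ (Fin n)

/-- The complex of singular chains with integer coefficients. -/
abbrev singularChains : TopCat.{0} ⥤ ChainComplex (ModuleCat.{0} ℤ) ℕ :=
  (AlgebraicTopology.singularChainComplexFunctor (ModuleCat.{0} ℤ)).obj (ModuleCat.of ℤ ℤ)

/-- `H_n(X, A; ℤ)` for a map `A ⟶ X` (in use: the inclusion of a subspace): the homology of the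
quotient of the singular chains of `X` by those of `A`. -/
def relHomology (n : ℕ) (i : Arrow TopCat.{0}) : ModuleCat.{0} ℤ :=
  (cokernel (singularChains.map i.hom)).homology n

/-- The homomorphism of relative homology groups induced by a map of pairs. -/
def relHomologyMap (n : ℕ) {i j : Arrow TopCat.{0}} (f : i ⟶ j) :
    relHomology n i ⟶ relHomology n j :=
  HomologicalComplex.homologyMap
    (cokernel.map (singularChains.map i.hom) (singularChains.map j.hom)
      (singularChains.map f.left) (singularChains.map f.right)
      (by rw [← Functor.map_comp, ← Functor.map_comp]; exact congrArg _ f.w.symm)) n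

/-- The pair `(X, X - {x})`. -/
def puncturedPair (X : Type) [TopologicalSpace X] (x : X) : Arrow TopCat.{0} :=
  Arrow.mk (Y := TopCat.of X)
    (TopCat.ofHom (⟨Subtype.val, continuous_subtype_val⟩ : C({y : X // y ≠ x}, X)))

/-- The map of pairs `(X, X - {x}) → (Y, Y - {y})` given by an injective continuous map that
sends `x` to `y`. -/
def puncturedPairMap {X Y : Type} [TopologicalSpace X] [TopologicalSpace Y] (f : C(X, Y))
    (hf : Function.Injective f) {x : X} {y : Y} (h : f x = y) :
    puncturedPair X x ⟶ puncturedPair Y y :=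
  Arrow.homMk
    (TopCat.ofHom (⟨fun z => ⟨f z.1, fun e => z.2 (hf (e.trans h.symm))⟩, by fun_prop⟩ :
      C({z : X // z ≠ x}, {z : Y // z ≠ y})))
    (TopCat.ofHom f) (by ext z; rfl)

/-- For a homeomorphism `f` from an open set `U` onto an open set of `ℝⁿ` and `x ∈ U`, the map
`y ↦ f y - f x` on `U`. -/
def centeredAt {n : ℕ} (f : OpenPartialHomeomorph (Euc n) (Euc n)) (x : f.source) :
    C(f.source, Euc n) :=
  ⟨fun y => f y - f x, (f.continuousOn.domRestrict).sub continuous_const⟩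

theorem centeredAt_injective {n : ℕ} (f : OpenPartialHomeomorph (Euc n) (Euc n))
    (x : f.source) : Function.Injective (centeredAt f x) := fun y z h =>
  Subtype.ext (f.injOn y.2 z.2 (sub_left_injective h))

theorem centeredAt_self {n : ℕ} (f : OpenPartialHomeomorph (Euc n) (Euc n)) (x : f.source) :
    centeredAt f x x = 0 := sub_self _

/-- For `x ∈ U`, the map `y ↦ y - x` on `U`. -/
def translateAt {n : ℕ} (f : OpenPartialHomeomorph (Euc n) (Euc n)) (x : f.source) :
    C(f.source, Euc n) :=
  ⟨fun y => (y : Euc n) - x, continuous_subtype_val.sub continuous_const⟩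

theorem translateAt_injective {n : ℕ} (f : OpenPartialHomeomorph (Euc n) (Euc n))
    (x : f.source) : Function.Injective (translateAt f x) := fun _ _ h =>
  Subtype.ext (sub_left_injective h)

theorem translateAt_self {n : ℕ} (f : OpenPartialHomeomorph (Euc n) (Euc n)) (x : f.source) :
    translateAt f x x = 0 := sub_self _

/-- A homeomorphism `f : U → V` between open subsets of `ℝⁿ`, `n ≥ 1`, preserves the orientation
if for every `x ∈ U` the two homomorphisms
`H_n(U, U - {x}) → H_n(ℝⁿ, ℝⁿ - {0})` induced by `y ↦ y - x` and by `y ↦ f y - f x` agree. Both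
are isomorphisms (excision and translation), so this says that the composite
`H_n(ℝⁿ, ℝⁿ - {0}) ≅ H_n(U, U - {x}) → H_n(V, V - {f x}) ≅ H_n(ℝⁿ, ℝⁿ - {0})` is the identity. -/
def PreservesEuc {n : ℕ} (f : OpenPartialHomeomorph (Euc n) (Euc n)) : Prop :=
  ∀ x : f.source,
    relHomologyMap n
        (puncturedPairMap (centeredAt f x) (centeredAt_injective f x) (centeredAt_self f x)) =
      relHomologyMap n
        (puncturedPairMap (translateAt f x) (translateAt_injective f x) (translateAt_self f x))

/-- Both coordinate changes between two charts preserve the orientation. -/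
def OrientedCompatible {n : ℕ} {X : Type} [TopologicalSpace X]
    (φ ψ : OpenPartialHomeomorph X (Euc n)) : Prop :=
  PreservesEuc (φ.symm.trans ψ) ∧ PreservesEuc (ψ.symm.trans φ)

/-- `A` is an oriented atlas of the `n`-dimensional manifold `W`, an open subset of `X`. -/
structure IsOrientedAtlas {n : ℕ} {X : Type} [TopologicalSpace X] (W : Set X)
    (A : Set (OpenPartialHomeomorph X (Euc n))) : Prop where
  subset : ∀ φ ∈ A, φ.source ⊆ W
  cover : ∀ x ∈ W, ∃ φ ∈ A, x ∈ φ.source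
  compatible : ∀ φ ∈ A, ∀ ψ ∈ A, OrientedCompatible φ ψ

/-- `A` is an orientation of the `n`-dimensional manifold `W ⊆ X`, `n ≥ 1`: a maximal oriented
atlas. -/
structure IsOrientation {n : ℕ} {X : Type} [TopologicalSpace X] (W : Set X)
    (A : Set (OpenPartialHomeomorph X (Euc n))) : Prop extends IsOrientedAtlas W A where
  maximal : ∀ χ : OpenPartialHomeomorph X (Euc n), IsOrientedAtlas W (insert χ A) → χ ∈ A

/-- All charts of `W` that are compatible with the charts in `B`. If `B` consists of pairwise
compatible charts that cover a dense subset of `W`, and some orientation of `W` contains `B`, then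
this is that orientation. -/
def generatedOrientation {n : ℕ} {X : Type} [TopologicalSpace X] (W : Set X)
    (B : Set (OpenPartialHomeomorph X (Euc n))) : Set (OpenPartialHomeomorph X (Euc n)) :=
  {χ | χ.source ⊆ W ∧ ∀ φ ∈ B, OrientedCompatible χ φ}

/-- A homeomorphism is orientation preserving if it matches the two maximal oriented atlases. -/
def PreservesOrientation {n : ℕ} {X Y : Type} [TopologicalSpace X] [TopologicalSpace Y]
    (A : Set (OpenPartialHomeomorph X (Euc n))) (B : Set (OpenPartialHomeomorph Y (Euc n)))
    (F : X ≃ₜ Y) : Prop :=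
  ∀ φ : OpenPartialHomeomorph X (Euc n),
    φ ∈ A ↔ F.symm.toOpenPartialHomeomorph.trans φ ∈ B

/-- The reflection of `ℝⁿ` that changes the sign of the last coordinate. -/
def reflectLast (n : ℕ) : Euc n ≃ₜ Euc n where
  toFun x := WithLp.toLp 2 fun i => if (i : ℕ) + 1 = n then -x i else x i
  invFun x := WithLp.toLp 2 fun i => if (i : ℕ) + 1 = n then -x i else x i
  left_inv x := by ext i; by_cases h : (i : ℕ) + 1 = n <;> simp [h]
  right_inv x := by ext i; by_cases h : (i : ℕ) + 1 = n <;> simp [h]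
  continuous_toFun := by
    refine (PiLp.continuous_toLp 2 _).comp (continuous_pi fun i => ?_)
    split_ifs <;> fun_prop
  continuous_invFun := by
    refine (PiLp.continuous_toLp 2 _).comp (continuous_pi fun i => ?_)
    split_ifs <;> fun_prop

/-- The opposite orientation. -/
def oppositeOrientation {n : ℕ} {X : Type} [TopologicalSpace X]
    (A : Set (OpenPartialHomeomorph X (Euc n))) : Set (OpenPartialHomeomorph X (Euc n)) :=
  (fun φ => φ.transHomeomorph (reflectLast n)) '' A

/-! ### Manifolds with boundary -/

/-- The closed half-space of `ℝᵈ` where the last coordinate is nonnegative. -/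
def halfSpace (d : ℕ) : Set (Euc d) := {x | ∀ i : Fin d, (i : ℕ) + 1 = d → 0 ≤ x i}

/-- The hyperplane of `ℝᵈ` where the last coordinate vanishes. -/
def hyperplane (d : ℕ) : Set (Euc d) := {x | ∀ i : Fin d, (i : ℕ) + 1 = d → x i = 0}

/-- The first `d - 1` coordinates of a point of `ℝᵈ`. -/
def dropLast (d : ℕ) (x : Euc d) : Euc (d - 1) :=
  WithLp.toLp 2 fun i => x (Fin.castLE (Nat.sub_le d 1) i)

/-- The point of `ℝᵈ` with first `d - 1` coordinates `v` and last coordinate `t`. -/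
def appendLast (d : ℕ) (v : Euc (d - 1)) (t : ℝ) : Euc d :=
  WithLp.toLp 2 fun i => if h : (i : ℕ) < d - 1 then v ⟨i, h⟩ else t

/-- `M` is a compact `d`-dimensional topological manifold with boundary. -/
structure IsCompactManifold (d : ℕ) (M : Type) [TopologicalSpace M] : Prop where
  compact : CompactSpace M
  hausdorff : T2Space M
  secondCountable : SecondCountableTopology M
  chart : ∀ x : M, ∃ φ : OpenPartialHomeomorph M (halfSpace d), x ∈ φ.source

/-- The boundary: the points mapped into the hyperplane by some chart. -/
def manifoldBoundary (d : ℕ) (M : Type) [TopologicalSpace M] : Set M :=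
  {x | ∃ φ : OpenPartialHomeomorph M (halfSpace d),
    x ∈ φ.source ∧ (φ x : Euc d) ∈ hyperplane d}

/-- The interior of a manifold with boundary. An orientation of `M` is an orientation of it. -/
def manifoldInterior (d : ℕ) (M : Type) [TopologicalSpace M] : Set M := (manifoldBoundary d M)ᶜ

/-- The half-space chart `φ` of `M`, restricted to the interior, belongs to the orientation `O`. -/
def IsPositiveChart {d : ℕ} {M : Type} [TopologicalSpace M]
    (O : Set (OpenPartialHomeomorph M (Euc d))) (φ : OpenPartialHomeomorph M (halfSpace d)) :
    Prop :=
  ∃ ψ ∈ O, ψ.source = φ.source ∩ manifoldInterior d M ∧ ∀ x ∈ ψ.source, ψ x = (φ x : Euc d)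

/-- The orientation that the orientation `O` of `M` induces on a union `S` of components of the
boundary (`d ≥ 2`): it is generated by the restrictions to `S` of the positive half-space charts. -/
def inducedOrientation {d : ℕ} {M : Type} [TopologicalSpace M]
    (O : Set (OpenPartialHomeomorph M (Euc d))) (S : Set M) :
    Set (OpenPartialHomeomorph S (Euc (d - 1))) :=
  generatedOrientation Set.univ
    {χ | ∃ φ : OpenPartialHomeomorph M (halfSpace d), IsPositiveChart O φ ∧
      χ.source = {s : S | (s : M) ∈ φ.source} ∧ ∀ s ∈ χ.source, χ s = dropLast d (φ s)}

/-- The embedding `f`, whose image is a union of components of the boundary of `M`, preserves the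
orientation with respect to the induced orientation of its image. -/
def EmbeddingPreserves {d : ℕ} {X M : Type} [TopologicalSpace X] [TopologicalSpace M]
    (A : Set (OpenPartialHomeomorph X (Euc (d - 1)))) (O : Set (OpenPartialHomeomorph M (Euc d)))
    {f : X → M} (hf : Topology.IsEmbedding f) : Prop :=
  PreservesOrientation A (inducedOrientation O (Set.range f)) hf.toHomeomorph

/-- Likewise, the embedding `f` reverses the orientation. -/
def EmbeddingReverses {d : ℕ} {X M : Type} [TopologicalSpace X] [TopologicalSpace M]
    (A : Set (OpenPartialHomeomorph X (Euc (d - 1)))) (O : Set (OpenPartialHomeomorph M (Euc d)))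
    {f : X → M} (hf : Topology.IsEmbedding f) : Prop :=
  PreservesOrientation A (oppositeOrientation (inducedOrientation O (Set.range f)))
    hf.toHomeomorph

/-! ### Collections of spheres -/

/-- The vector `(3i, 0, …, 0)` of `ℝᵈ`. -/
def sphereCenter (d i : ℕ) : Euc d :=
  WithLp.toLp 2 fun j => if (j : ℕ) = 0 then 3 * (i : ℝ) else 0

/-- The unit sphere `S_i` with center `(3i, 0, …, 0)` in `ℝᵈ`. -/
def sphereAt (d i : ℕ) : Set (Euc d) := Metric.sphere (sphereCenter d i) 1

/-- The object `S_0 ∪ … ∪ S_{n-1}`. -/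
def spheres (d n : ℕ) : Set (Euc d) := ⋃ i ∈ Finset.range n, sphereAt d i

/-- A choice of an orientation of the sphere `S_0`. -/
structure SphereOrientation (d : ℕ) where
  atlas : Set (OpenPartialHomeomorph (sphereAt d 0) (Euc (d - 1)))
  isOrientation : IsOrientation Set.univ atlas

/-- The orientation of `S_0 ∪ … ∪ S_{n-1}` for which each `S_i` carries the orientation of `S_0`,
transported by the translation by `(3i, 0, …, 0)`. -/
def spheresOrientation {d : ℕ} (o : SphereOrientation d) (n : ℕ) :
    Set (OpenPartialHomeomorph (spheres d n) (Euc (d - 1))) :=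
  generatedOrientation Set.univ
    {χ | ∃ i < n, ∃ φ ∈ o.atlas,
      (∀ z : spheres d n, z ∈ χ.source ↔
        ∃ w ∈ φ.source, (z : Euc d) = (w : Euc d) + sphereCenter d i) ∧
      ∀ z ∈ χ.source, ∀ w : sphereAt d 0, (z : Euc d) = (w : Euc d) + sphereCenter d i →
        χ z = φ w}

/-! ### Cobordisms -/

/-- The data of a cobordism: a space, a family of charts of its interior and two maps into it. -/
structure CobordismData (d n m : ℕ) where
  carrier : Type
  [topology : TopologicalSpace carrier]
  orientation : Set (OpenPartialHomeomorph carrier (Euc d))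
  ingoing : spheres d n → carrier
  outgoing : spheres d m → carrier

attribute [instance] CobordismData.topology

/-- A homeomorphism carries the boundary to the boundary. -/
theorem mem_manifoldBoundary_iff {d : ℕ} {X Y : Type} [TopologicalSpace X] [TopologicalSpace Y]
    (F : X ≃ₜ Y) (x : X) : F x ∈ manifoldBoundary d Y ↔ x ∈ manifoldBoundary d X := by
  constructor
  · rintro ⟨φ, h1, h2⟩
    exact ⟨F.toOpenPartialHomeomorph.trans φ, by simpa using h1, by simpa using h2⟩
  · rintro ⟨φ, h1, h2⟩
    exact ⟨F.symm.toOpenPartialHomeomorph.trans φ, by simpa using h1, by simpa using h2⟩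

theorem orientedCompatible_symm_trans {n : ℕ} {X Y : Type} [TopologicalSpace X]
    [TopologicalSpace Y] (F : X ≃ₜ Y) (φ ψ : OpenPartialHomeomorph X (Euc n)) :
    OrientedCompatible (F.symm.toOpenPartialHomeomorph.trans φ)
      (F.symm.toOpenPartialHomeomorph.trans ψ) ↔ OrientedCompatible φ ψ := by
  have key : ∀ α β : OpenPartialHomeomorph X (Euc n),
      (F.symm.toOpenPartialHomeomorph.trans α).symm.trans
        (F.symm.toOpenPartialHomeomorph.trans β) = α.symm.trans β := by
    intro α β
    rw [OpenPartialHomeomorph.trans_symm_eq_symm_trans_symm, OpenPartialHomeomorph.trans_assoc,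
      ← OpenPartialHomeomorph.trans_assoc _ _ β, ← Homeomorph.symm_toOpenPartialHomeomorph,
      ← Homeomorph.trans_toOpenPartialHomeomorph]
    simp
  unfold OrientedCompatible
  rw [key, key]

/-- Matching families of charts generate matching orientations. -/
theorem preserves_generated {d : ℕ} {X Y : Type} [TopologicalSpace X] [TopologicalSpace Y]
    (F : X ≃ₜ Y) (A : Set (OpenPartialHomeomorph X (Euc d)))
    (B : Set (OpenPartialHomeomorph Y (Euc d))) (h : PreservesOrientation A B F) :
    PreservesOrientation (generatedOrientation (manifoldInterior d X) A)
      (generatedOrientation (manifoldInterior d Y) B) F := by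
  intro χ
  refine and_congr ?_ ?_
  · have hs : (F.symm.toOpenPartialHomeomorph.trans χ).source = F.symm ⁻¹' χ.source := by simp
    rw [hs]
    constructor
    · intro hχ y hy hb
      refine hχ hy ?_
      rw [← mem_manifoldBoundary_iff F]
      simpa using hb
    · intro hχ x hx hb
      refine hχ (a := F x) (by simpa using hx) ?_
      exact (mem_manifoldBoundary_iff F x).2 hb
  · constructor
    · intro hχ φ hφ
      have e : F.symm.toOpenPartialHomeomorph.trans (F.toOpenPartialHomeomorph.trans φ) = φ := by
        rw [← OpenPartialHomeomorph.trans_assoc, ← Homeomorph.trans_toOpenPartialHomeomorph]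
        simp
      rw [← e, orientedCompatible_symm_trans]
      exact hχ _ ((h _).2 (by rwa [e]))
    · intro hχ φ hφ
      rw [← orientedCompatible_symm_trans F]
      exact hχ _ ((h φ).1 hφ)

/-- Compatible homeomorphisms match the families of charts transported to the glued spaces. -/
theorem transport_charts {d : ℕ} {X X' Z Z' : Type} [TopologicalSpace X] [TopologicalSpace X']
    [TopologicalSpace Z] [TopologicalSpace Z'] (G : X ≃ₜ X') (H : Z ≃ₜ Z') (i : X → Z)
    (i' : X' → Z') {A : Set (OpenPartialHomeomorph X (Euc d))}
    {A' : Set (OpenPartialHomeomorph X' (Euc d))} (hA : PreservesOrientation A A' G)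
    (hi : ∀ x, H (i x) = i' (G x)) (χ : OpenPartialHomeomorph Z (Euc d)) :
    (∃ φ ∈ A, χ.source = i '' φ.source ∧ ∀ x ∈ φ.source, χ (i x) = φ x) ↔
      ∃ φ ∈ A', (H.symm.toOpenPartialHomeomorph.trans χ).source = i' '' φ.source ∧
        ∀ x ∈ φ.source, (H.symm.toOpenPartialHomeomorph.trans χ) (i' x) = φ x := by
  have hs : (H.symm.toOpenPartialHomeomorph.trans χ).source = H '' χ.source := by
    simp [Homeomorph.image_eq_preimage_symm]
  have hi' : ∀ x, H.symm (i' x) = i (G.symm x) := fun x => by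
    rw [Homeomorph.symm_apply_eq, hi, G.apply_symm_apply]
  constructor
  · rintro ⟨φ, hφ, h1, h2⟩
    refine ⟨_, (hA φ).1 hφ, ?_, ?_⟩
    · rw [hs, h1]
      ext z
      constructor
      · rintro ⟨_, ⟨x, hx, rfl⟩, rfl⟩
        exact ⟨G x, by simpa using hx, (hi x).symm⟩
      · rintro ⟨x, hx, rfl⟩
        refine ⟨_, ⟨G.symm x, by simpa using hx, rfl⟩, ?_⟩
        rw [hi, G.apply_symm_apply]
    · intro x hx
      have hx' : G.symm x ∈ φ.source := by simpa using hx
      simpa [hi'] using h2 _ hx'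
  · rintro ⟨φ, hφ, h1, h2⟩
    have e : G.symm.toOpenPartialHomeomorph.trans (G.toOpenPartialHomeomorph.trans φ) = φ := by
      rw [← OpenPartialHomeomorph.trans_assoc, ← Homeomorph.trans_toOpenPartialHomeomorph]
      simp
    refine ⟨G.toOpenPartialHomeomorph.trans φ, (hA _).2 (by rwa [e]), ?_, ?_⟩
    · rw [hs] at h1
      apply H.injective.image_injective
      rw [h1]
      ext z
      constructor
      · rintro ⟨x, hx, rfl⟩
        refine ⟨_, ⟨G.symm x, by simpa using hx, rfl⟩, ?_⟩
        rw [hi, G.apply_symm_apply]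
      · rintro ⟨_, ⟨x, hx, rfl⟩, rfl⟩
        exact ⟨G x, by simpa using hx, (hi x).symm⟩
    · intro x hx
      have hx' : G x ∈ φ.source := by simpa using hx
      have := h2 _ hx'
      simpa [hi'] using this

namespace CobordismData

/-- The data form a `d`-cobordism, `d ≥ 2`, from `S_0 ∪ … ∪ S_{n-1}` to `S_0 ∪ … ∪ S_{m-1}`. -/
structure IsCobordism {d n m : ℕ} (o : SphereOrientation d) (K : CobordismData d n m) : Prop where
  manifold : IsCompactManifold d K.carrier
  isOrientation : IsOrientation (manifoldInterior d K.carrier) K.orientation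
  ingoing_embedding : Topology.IsEmbedding K.ingoing
  outgoing_embedding : Topology.IsEmbedding K.outgoing
  disjoint : Disjoint (Set.range K.ingoing) (Set.range K.outgoing)
  union : Set.range K.ingoing ∪ Set.range K.outgoing = manifoldBoundary d K.carrier
  ingoing_preserves : EmbeddingPreserves (spheresOrientation o n) K.orientation ingoing_embedding
  outgoing_reverses : EmbeddingReverses (spheresOrientation o m) K.orientation outgoing_embedding

/-- Equivalence: an orientation preserving homeomorphism that commutes with the embeddings. -/
def Equivalent {d n m : ℕ} (K L : CobordismData d n m) : Prop :=
  ∃ F : K.carrier ≃ₜ L.carrier, PreservesOrientation K.orientation L.orientation F ∧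
    F ∘ K.ingoing = L.ingoing ∧ F ∘ K.outgoing = L.outgoing

theorem Equivalent.refl {d n m : ℕ} (K : CobordismData d n m) : K.Equivalent K :=
  ⟨Homeomorph.refl _, fun φ => by simp, rfl, rfl⟩

theorem Equivalent.symm {d n m : ℕ} {K L : CobordismData d n m} :
    K.Equivalent L → L.Equivalent K := by
  rintro ⟨F, hF, h0, h1⟩
  refine ⟨F.symm, fun φ => ?_, ?_, ?_⟩
  · rw [hF, ← OpenPartialHomeomorph.trans_assoc, ← Homeomorph.trans_toOpenPartialHomeomorph]
    simp
  · rw [← h0, ← Function.comp_assoc]; simp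
  · rw [← h1, ← Function.comp_assoc]; simp

theorem Equivalent.trans {d n m : ℕ} {K L P : CobordismData d n m} :
    K.Equivalent L → L.Equivalent P → K.Equivalent P := by
  rintro ⟨F, hF, h0, h1⟩ ⟨G, hG, g0, g1⟩
  refine ⟨F.trans G, fun φ => ?_, ?_, ?_⟩
  · rw [hF, hG, ← OpenPartialHomeomorph.trans_assoc, ← Homeomorph.trans_toOpenPartialHomeomorph]
    rfl
  · rw [← g0, ← h0]; rfl
  · rw [← g1, ← h1]; rfl

/-- The identity cobordism: the cylinder `(S_0 ∪ … ∪ S_{n-1}) × [0, 1]` with the product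
orientation, where `[0, 1]` is oriented by the identity, and with its two ends. -/
def identity {d : ℕ} (o : SphereOrientation d) (n : ℕ) : CobordismData d n n where
  carrier := spheres d n × unitInterval
  orientation := generatedOrientation (manifoldInterior d (spheres d n × unitInterval))
    {χ | ∃ φ ∈ spheresOrientation o n,
      χ.source = φ.source ×ˢ {t : unitInterval | 0 < t ∧ t < 1} ∧
      ∀ p ∈ χ.source, χ p = appendLast d (φ p.1) p.2}
  ingoing z := (z, 0)
  outgoing z := (z, 1)

/-- The relation on the disjoint union that identifies the outgoing boundary of `K` with the
ingoing boundary of `L`. -/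
inductive GlueRel {d n m k : ℕ} (K : CobordismData d n m) (L : CobordismData d m k) :
    L.carrier ⊕ K.carrier → L.carrier ⊕ K.carrier → Prop
  | glue (z : spheres d m) : GlueRel K L (Sum.inl (L.ingoing z)) (Sum.inr (K.outgoing z))

/-- The pushout space, with the quotient topology; `Quot` takes the smallest equivalence relation
that contains the given relation. -/
abbrev GlueSpace {d n m k : ℕ} (K : CobordismData d n m) (L : CobordismData d m k) : Type :=
  Quot (GlueRel K L)

/-- The composition of `K : n → m` and `L : m → k`: the two manifolds glued along
`S_0 ∪ … ∪ S_{m-1}`, with the orientation for which the embeddings of the interiors of the two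
manifolds are orientation preserving. -/
def glue {d n m k : ℕ} (K : CobordismData d n m) (L : CobordismData d m k) :
    CobordismData d n k where
  carrier := GlueSpace K L
  orientation := generatedOrientation (manifoldInterior d (GlueSpace K L))
    ({χ | ∃ φ ∈ L.orientation, χ.source = (fun x => Quot.mk _ (Sum.inl x)) '' φ.source ∧
        ∀ x ∈ φ.source, χ (Quot.mk _ (Sum.inl x)) = φ x} ∪
      {χ | ∃ φ ∈ K.orientation, χ.source = (fun x => Quot.mk _ (Sum.inr x)) '' φ.source ∧
        ∀ x ∈ φ.source, χ (Quot.mk _ (Sum.inr x)) = φ x})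
  ingoing z := Quot.mk _ (Sum.inr (K.ingoing z))
  outgoing z := Quot.mk _ (Sum.inl (L.outgoing z))

/-- The homeomorphism of the glued spaces induced by homeomorphisms of the pieces. -/
def glueHomeomorph {d n m k : ℕ} {K K' : CobordismData d n m} {L L' : CobordismData d m k}
    (F : K.carrier ≃ₜ K'.carrier) (G : L.carrier ≃ₜ L'.carrier)
    (hF : F ∘ K.outgoing = K'.outgoing) (hG : G ∘ L.ingoing = L'.ingoing) :
    GlueSpace K L ≃ₜ GlueSpace K' L' where
  toEquiv := Quot.congr (G.toEquiv.sumCongr F.toEquiv) (by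
    intro a b
    constructor
    · rintro ⟨z⟩
      have h1 := congrFun hF z
      have h2 := congrFun hG z
      simp only [Function.comp_apply] at h1 h2
      simpa [h1, h2] using GlueRel.glue (K := K') (L := L') z
    · intro h
      generalize ha : (G.toEquiv.sumCongr F.toEquiv) a = a' at h
      generalize hb : (G.toEquiv.sumCongr F.toEquiv) b = b' at h
      obtain ⟨z⟩ := h
      have h1 : F (K.outgoing z) = K'.outgoing z := congrFun hF z
      have h2 : G (L.ingoing z) = L'.ingoing z := congrFun hG z
      rcases a with a | a <;> rcases b with b | b <;> simp at ha hb
      rw [← h2] at ha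
      rw [← h1] at hb
      rw [G.injective ha, F.injective hb]
      exact .glue z)
  continuous_toFun := by
    refine continuous_quot_lift _ (continuous_quot_mk.comp ?_)
    exact G.continuous.sumMap F.continuous
  continuous_invFun := by
    refine continuous_quot_lift _ (continuous_quot_mk.comp ?_)
    exact G.symm.continuous.sumMap F.symm.continuous

/-- Equivalence is a congruence with respect to gluing. -/
theorem Equivalent.glue {d n m k : ℕ} {K K' : CobordismData d n m} {L L' : CobordismData d m k} :
    K.Equivalent K' → L.Equivalent L' → (K.glue L).Equivalent (K'.glue L') := by
  rintro ⟨F, oF, f0, f1⟩ ⟨G, oG, g0, g1⟩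
  let H := glueHomeomorph F G f1 g0
  refine ⟨H, preserves_generated H _ _ ?_, ?_, ?_⟩
  · intro χ
    refine or_congr ?_ ?_
    · exact transport_charts G H _ _ oG (fun _ => rfl) χ
    · exact transport_charts F H _ _ oF (fun _ => rfl) χ
  · exact funext fun z => congrArg (fun x => Quot.mk (GlueRel K' L') (Sum.inr x)) (congrFun f0 z)
  · exact funext fun z => congrArg (fun x => Quot.mk (GlueRel K' L') (Sum.inl x)) (congrFun g1 z)

end CobordismData

/-! ### The category of cobordisms between collections of spheres -/

/-- A `d`-cobordism from `S_0 ∪ … ∪ S_{n-1}` to `S_0 ∪ … ∪ S_{m-1}`. -/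
structure Cobordism {d : ℕ} (o : SphereOrientation d) (n m : ℕ) where
  data : CobordismData d n m
  isCobordism : data.IsCobordism o

instance cobordismSetoid (d n m : ℕ) : Setoid (CobordismData d n m) where
  r := CobordismData.Equivalent
  iseqv := ⟨.refl, .symm, .trans⟩

namespace DCobS

/-- Equivalence classes of cobordism data. -/
def DataClass (d n m : ℕ) : Type 1 := Quotient (cobordismSetoid d n m)

/-- The class of the identity cobordism. -/
def one {d : ℕ} (o : SphereOrientation d) (n : ℕ) : DataClass d n n :=
  Quotient.mk _ (CobordismData.identity o n)

/-- Composition of classes, by gluing representatives: first `κ`, then `μ`. -/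
def comp {d n m k : ℕ} (κ : DataClass d n m) (μ : DataClass d m k) : DataClass d n k :=
  Quotient.map₂ CobordismData.glue (fun _ _ h _ _ h' => CobordismData.Equivalent.glue h h') κ μ

/-- The arrows of `dCobS`: equivalence classes of cobordisms. -/
def Hom {d : ℕ} (o : SphereOrientation d) (n m : ℕ) : Type 1 :=
  {κ : DataClass d n m // ∃ K : Cobordism o n m, κ = Quotient.mk _ K.data}

/-- The arrow given by a cobordism. -/
def arrow {d : ℕ} {o : SphereOrientation d} {n m : ℕ} (K : Cobordism o n m) : Hom o n m :=
  ⟨Quotient.mk _ K.data, K, rfl⟩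

/-- `κ` is an isomorphism of `dCobS`: it has a two-sided inverse. -/
def IsIsomorphism {d : ℕ} {o : SphereOrientation d} {n m : ℕ} (κ : Hom o n m) : Prop :=
  ∃ μ : Hom o m n, comp κ.1 μ.1 = one o n ∧ comp μ.1 κ.1 = one o m

/-- `dCobS` is skeletal: isomorphic objects `S_0 ∪ … ∪ S_{n-1}`, `S_0 ∪ … ∪ S_{m-1}` are equal. -/
def IsSkeletal {d : ℕ} (o : SphereOrientation d) : Prop :=
  ∀ n m : ℕ, (∃ κ : Hom o n m, IsIsomorphism κ) → spheres d n = spheres d m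

end DCobS

end

/-! ### The PROP freely generated by a commutative Frobenius object -/

namespace Frob

/-- Words built from the primitive symbols, composition and tensor. -/
inductive Word : Type
  | one (n : ℕ)
  | tau (n m : ℕ)
  | mul
  | unit
  | comul
  | counit
  | comp (g f : Word)
  | tensor (f g : Word)

/-- The word is a term with the given source and target. -/
inductive HasType : Word → ℕ → ℕ → Prop
  | one (n : ℕ) : HasType (.one n) n n
  | tau (n m : ℕ) : HasType (.tau n m) (n + m) (m + n)
  | mul : HasType .mul 2 1
  | unit : HasType .unit 0 1
  | comul : HasType .comul 1 2
  | counit : HasType .counit 1 0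
  | comp {f g : Word} {n m p : ℕ} : HasType f n m → HasType g m p → HasType (.comp g f) n p
  | tensor {f g : Word} {n m p q : ℕ} : HasType f n m → HasType g p q →
      HasType (.tensor f g) (n + p) (m + q)

/-- Composition of words. -/
infixr:80 " ∘' " => Word.comp

/-- Tensor of words. -/
infixr:85 " ⊗' " => Word.tensor

/-- The theorems `f = g` of the equational system of symmetric strict monoidal categories with a
commutative Frobenius object. -/
inductive Equal : Word → Word → Prop
  | refl {f : Word} {n m : ℕ} : HasType f n m → Equal f f
  | str_right {f : Word} {n m : ℕ} : HasType f n m → Equal (f ⊗' .one 0) f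
  | str_left {f : Word} {n m : ℕ} : HasType f n m → Equal (.one 0 ⊗' f) f
  | str_assoc {f₁ f₂ f₃ : Word} {n₁ m₁ n₂ m₂ n₃ m₃ : ℕ} : HasType f₁ n₁ m₁ → HasType f₂ n₂ m₂ →
      HasType f₃ n₃ m₃ → Equal ((f₁ ⊗' f₂) ⊗' f₃) (f₁ ⊗' (f₂ ⊗' f₃))
  | cat_right {f : Word} {n m : ℕ} : HasType f n m → Equal (f ∘' .one n) f
  | cat_left {f : Word} {n m : ℕ} : HasType f n m → Equal (.one m ∘' f) f
  | cat_assoc {f g h : Word} {n m p q : ℕ} : HasType f n m → HasType g m p → HasType h p q →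
      Equal ((h ∘' g) ∘' f) (h ∘' (g ∘' f))
  | fun_one (n m : ℕ) : Equal (.one n ⊗' .one m) (.one (n + m))
  | fun_comp {f₁ f₂ g₁ g₂ : Word} {n₁ m₁ p₁ n₂ m₂ p₂ : ℕ} : HasType f₁ n₁ m₁ →
      HasType g₁ m₁ p₁ → HasType f₂ n₂ m₂ → HasType g₂ m₂ p₂ →
      Equal ((g₁ ∘' f₁) ⊗' (g₂ ∘' f₂)) ((g₁ ⊗' g₂) ∘' (f₁ ⊗' f₂))
  | nat {f₁ f₂ : Word} {n₁ m₁ n₂ m₂ : ℕ} : HasType f₁ n₁ m₁ → HasType f₂ n₂ m₂ →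
      Equal (.tau m₁ m₂ ∘' (f₁ ⊗' f₂)) ((f₂ ⊗' f₁) ∘' .tau n₁ n₂)
  | inv (n m : ℕ) : Equal (.tau m n ∘' .tau n m) (.one (n + m))
  | hex (n m p : ℕ) :
      Equal (.tau (n + m) p) ((.tau n p ⊗' .one m) ∘' (.one n ⊗' .tau m p))
  | assoc : Equal (.mul ∘' (.mul ⊗' .one 1)) (.mul ∘' (.one 1 ⊗' .mul))
  | unit_left : Equal (.mul ∘' (.unit ⊗' .one 1)) (.one 1)
  | unit_right : Equal (.mul ∘' (.one 1 ⊗' .unit)) (.one 1)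
  | coassoc : Equal ((.comul ⊗' .one 1) ∘' .comul) ((.one 1 ⊗' .comul) ∘' .comul)
  | counit_left : Equal ((.counit ⊗' .one 1) ∘' .comul) (.one 1)
  | counit_right : Equal ((.one 1 ⊗' .counit) ∘' .comul) (.one 1)
  | frob_left : Equal ((.mul ⊗' .one 1) ∘' (.one 1 ⊗' .comul)) (.comul ∘' .mul)
  | frob_right : Equal ((.one 1 ⊗' .mul) ∘' (.comul ⊗' .one 1)) (.comul ∘' .mul)
  | com : Equal (.mul ∘' .tau 1 1) .mul
  | cocom : Equal (.tau 1 1 ∘' .comul) .comul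
  | symm {f g : Word} : Equal f g → Equal g f
  | trans {f g h : Word} : Equal f g → Equal g h → Equal f h
  | comp_congr {f₁ f₂ g₁ g₂ : Word} {n m p : ℕ} : HasType f₁ n m → HasType f₂ n m →
      HasType g₁ m p → HasType g₂ m p → Equal f₁ f₂ → Equal g₁ g₂ →
      Equal (g₁ ∘' f₁) (g₂ ∘' f₂)
  | tensor_congr {f₁ f₂ g₁ g₂ : Word} : Equal f₁ g₁ → Equal f₂ g₂ → Equal (f₁ ⊗' f₂) (g₁ ⊗' g₂)

/-- Terms `n → m` up to provable equality. -/
instance homSetoid (n m : ℕ) : Setoid {w : Word // HasType w n m} where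
  r f g := Equal f.1 g.1
  iseqv := ⟨fun f => .refl f.2, .symm, .trans⟩

/-- The objects of the category `𝐊`: the natural numbers. -/
structure KCat : Type where
  /-- The tensor power. -/
  power : ℕ

/-- The category `𝐊`, presented by generators and relations. -/
instance : Category.{0} KCat where
  Hom n m := Quotient (homSetoid n.power m.power)
  id n := Quotient.mk _ ⟨.one n.power, .one _⟩
  comp := Quotient.map₂ (fun f g => ⟨g.1 ∘' f.1, .comp f.2 g.2⟩)
    (fun f₁ f₂ h g₁ g₂ k => .comp_congr f₁.2 f₂.2 g₁.2 g₂.2 h k)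
  id_comp f := by
    induction f using Quotient.inductionOn with
    | h f => exact Quotient.sound (.cat_right f.2)
  comp_id f := by
    induction f using Quotient.inductionOn with
    | h f => exact Quotient.sound (.cat_left f.2)
  assoc f g h := by
    induction f using Quotient.inductionOn with
    | h f =>
      induction g using Quotient.inductionOn with
      | h g =>
        induction h using Quotient.inductionOn with
        | h h => exact Quotient.sound (.symm (.cat_assoc f.2 g.2 h.2))

end Frob

open CategoryTheory

/-! ### Components of collections of spheres -/

/-! For cobordisms, count connected components. Suppose that `K : n → m` followed by `L : m → n` is
homeomorphic, rel its ends, to the cylinder on `n` spheres. The component `S_i × [0, 1]` runs from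
an ingoing sphere of `K` to an outgoing sphere of `L`, so it must cross the locus where the pieces
are glued (`exists_outgoing_of_glue_identity`). That locus is the image of `m` spheres, each
connected because `d ≥ 2`, so each lies in only one component (`eq_of_sphereIndex_eq`). Choosing a
gluing sphere in each component is therefore injective, and `n ≤ m`. The other composite gives `m ≤
n`.

For `𝐊`, words are interpreted as relations, with the generating object sent to a two-element set
and its `n`-th power to the lists of length `n`. This set is a commutative Frobenius object:
multiplication relates `(x, x)` to `x`, and comultiplication is the converse relation. Hence equal
words have equal interpretations (`Equal.rel_eq`). A relation with a left inverse contains an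
injective function, so an isomorphism `n → m` forces `2 ^ n ≤ 2 ^ m` and conversely. -/

theorem abs_sub_le_of_mem_sphereAt {d i : ℕ} (hd : 0 < d) {z : Euc d} (hz : z ∈ sphereAt d i) :
    |z ⟨0, hd⟩ - 3 * (i : ℝ)| ≤ 1 := by
  have h := PiLp.norm_apply_le (z - sphereCenter d i) ⟨0, hd⟩
  rw [mem_sphere_iff_norm.1 hz] at h
  simpa [sphereCenter] using h

/-- Centers are at least 3 apart and 1 + 3/2 < 3. The strict bound with the larger radius 3/2 turns
lying on a given sphere into an open condition on the first coordinate, which makes `sphereIndex`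
continuous. -/
theorem eq_of_abs_sub_three_mul {x : ℝ} {i j : ℕ} (hi : |x - 3 * (i : ℝ)| ≤ 1)
    (hj : |x - 3 * (j : ℝ)| < 3 / 2) : i = j := by
  rw [abs_le] at hi
  rw [abs_lt] at hj
  have h1 : (i : ℝ) < j + 1 := by linarith
  have h2 : (j : ℝ) < i + 1 := by linarith
  norm_cast at h1 h2
  omega

theorem exists_mem_sphereAt {d n : ℕ} (z : spheres d n) : ∃ i < n, (z : Euc d) ∈ sphereAt d i := by
  simpa [spheres] using z.2

/-- The number of the sphere that contains a point. -/
noncomputable def sphereIndex {d n : ℕ} (z : spheres d n) : ℕ := (exists_mem_sphereAt z).choose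

theorem sphereIndex_lt {d n : ℕ} (z : spheres d n) : sphereIndex z < n :=
  (exists_mem_sphereAt z).choose_spec.1

theorem mem_sphereAt_sphereIndex {d n : ℕ} (z : spheres d n) :
    (z : Euc d) ∈ sphereAt d (sphereIndex z) :=
  (exists_mem_sphereAt z).choose_spec.2

theorem sphereIndex_eq_iff {d n : ℕ} (hd : 0 < d) (z : spheres d n) (i : ℕ) :
    sphereIndex z = i ↔ |(z : Euc d) ⟨0, hd⟩ - 3 * (i : ℝ)| < 3 / 2 := by
  have h := abs_sub_le_of_mem_sphereAt hd (mem_sphereAt_sphereIndex z)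
  refine ⟨?_, eq_of_abs_sub_three_mul h⟩
  rintro rfl
  linarith

theorem continuous_sphereIndex {d n : ℕ} (hd : 0 < d) :
    Continuous (sphereIndex : spheres d n → ℕ) := by
  refine continuous_discrete_rng.2 fun i => ?_
  have : sphereIndex ⁻¹' {i} =
      {z : spheres d n | |(z : Euc d) ⟨0, hd⟩ - 3 * (i : ℝ)| < 3 / 2} :=
    Set.ext fun z => sphereIndex_eq_iff hd z i
  rw [this]
  exact isOpen_lt (by fun_prop) continuous_const

theorem exists_sphereIndex_eq {d n i : ℕ} (hd : 2 ≤ d) (hi : i < n) :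
    ∃ z : spheres d n, sphereIndex z = i := by
  have hd0 : 0 < d := by omega
  have : Nontrivial (Euc d) := by
    have : Nonempty (Fin d) := ⟨⟨0, hd0⟩⟩
    infer_instance
  obtain ⟨w, hw⟩ := NormedSpace.sphere_nonempty (x := sphereCenter d i).2 zero_le_one
  have hz : w ∈ spheres d n := by simpa [spheres] using ⟨i, hi, hw⟩
  refine ⟨⟨w, hz⟩, (sphereIndex_eq_iff hd0 _ i).2 ?_⟩
  have := abs_sub_le_of_mem_sphereAt hd0 hw
  simp only
  linarith

/-- This is where `d ≥ 2` is essential: for `d = 1` a sphere is a pair of points. -/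
theorem isPreconnected_sphereAt {d : ℕ} (hd : 2 ≤ d) (i : ℕ) : IsPreconnected (sphereAt d i) := by
  refine isPreconnected_sphere ?_ _ _
  rw [← Module.finrank_eq_rank, finrank_euclideanSpace_fin]
  exact_mod_cast hd

/-- A continuous function with discrete values is constant on each of the spheres. -/
theorem eq_of_sphereIndex_eq {d n : ℕ} (hd : 2 ≤ d) {f : spheres d n → ℕ} (hf : Continuous f)
    {z w : spheres d n} (h : sphereIndex z = sphereIndex w) : f z = f w := by
  have hsub : sphereAt d (sphereIndex z) ⊆ spheres d n := fun x hx => by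
    simpa [spheres] using ⟨_, sphereIndex_lt z, hx⟩
  have := isPreconnected_iff_preconnectedSpace.1 (isPreconnected_sphereAt hd (sphereIndex z))
  exact PreconnectedSpace.constant this (hf.comp (continuous_inclusion hsub))
    (x := ⟨z, mem_sphereAt_sphereIndex z⟩) (y := ⟨w, h ▸ mem_sphereAt_sphereIndex w⟩)

/-! ### Gluings that are cylinders -/

namespace CobordismData

/-- If a gluing is a cylinder, every component of the cylinder contains a point of the gluing
spheres; here components are told apart by a continuous function `g` with discrete values. -/
theorem exists_outgoing_of_glue_identity {d n m : ℕ}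
    {K : CobordismData d n m} {L : CobordismData d m n}
    (F : GlueSpace K L ≃ₜ spheres d n × unitInterval)
    (hin : ∀ z, F (Quot.mk _ (Sum.inr (K.ingoing z))) = (z, 0))
    (hout : ∀ z, F (Quot.mk _ (Sum.inl (L.outgoing z))) = (z, 1))
    {g : spheres d n → ℕ} (hg : Continuous g) (z : spheres d n) :
    ∃ w, g (F (Quot.mk _ (Sum.inr (K.outgoing w)))).1 = g z := by
  classical
  by_contra! hne
  have hgF : Continuous fun x : GlueSpace K L => g (F x).1 := by fun_prop
  -- `h` marks the part in `L` of the component of `z`, and nothing in `K`. If no gluing point lies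
  -- in that component, the two definitions agree on the glued points, so `h` descends to a
  -- continuous function on the glued space.
  let h : L.carrier ⊕ K.carrier → Bool :=
    Sum.elim (fun x => decide (g (F (Quot.mk _ (Sum.inl x))).1 = g z)) fun _ => false
  have hrel : ∀ a b, GlueRel K L a b → h a = h b := by
    rintro _ _ ⟨w⟩
    have e : (Quot.mk (GlueRel K L) (Sum.inl (L.ingoing w))) = Quot.mk _ (Sum.inr (K.outgoing w)) :=
      Quot.sound (.glue w)
    simpa [h, e] using hne w
  have hcont : Continuous h := by
    refine Continuous.sumElim ?_ continuous_const
    have : Continuous fun k : ℕ => decide (k = g z) := continuous_of_discreteTopology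
    exact this.comp (hgF.comp (continuous_quot_mk.comp continuous_inl))
  -- Follow `h` along the segment `{z} × [0, 1]`: it starts in `K`, where `h` is false, and ends in
  -- `L` over `z`, where `h` is true. This contradicts connectedness of the interval.
  have hpath : Continuous fun t : unitInterval => Quot.lift h hrel (F.symm (z, t)) :=
    (continuous_quot_lift hrel hcont).comp (F.symm.continuous.comp (by fun_prop))
  have key := PreconnectedSpace.constant inferInstance hpath (x := 0) (y := 1)
  rw [← hin z, ← hout z, F.symm_apply_apply, F.symm_apply_apply] at key
  simp [h, hout] at key

/-- Every component of the cylinder contains a gluing point, and all points of one gluing sphere lie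
in the same component. So different components use different gluing spheres. -/
theorem le_of_glue_equivalent_identity {d n m : ℕ} (hd : 2 ≤ d) {o : SphereOrientation d}
    {K : CobordismData d n m} {L : CobordismData d m n} (hK : Continuous K.outgoing)
    (h : (K.glue L).Equivalent (identity o n)) : n ≤ m := by
  obtain ⟨F, -, hin, hout⟩ := h
  have hidx := continuous_sphereIndex (d := d) (n := n) (by omega)
  choose p hp using fun i : Fin n => exists_sphereIndex_eq hd i.2
  choose w hw using fun i : Fin n =>
    exists_outgoing_of_glue_identity F (congrFun hin) (congrFun hout) hidx (p i)
  have hinj : Function.Injective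
      fun i : Fin n => (⟨sphereIndex (w i), sphereIndex_lt _⟩ : Fin m) := by
    intro i j hij
    -- The component of the cylinder reached from a gluing point; being continuous, it depends only
    -- on the gluing sphere.
    have hF : Continuous fun x : spheres d m =>
        sphereIndex (F (Quot.mk _ (Sum.inr (K.outgoing x)))).1 :=
      hidx.comp (continuous_fst.comp (F.continuous.comp
        (continuous_quot_mk.comp (continuous_inr.comp hK))))
    have := eq_of_sphereIndex_eq hd hF (Fin.mk.inj hij)
    exact Fin.ext ((hp i).symm.trans ((hw i).symm.trans (this.trans ((hw j).trans (hp j)))))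
  simpa using Fintype.card_le_of_injective _ hinj

end CobordismData

theorem DCobS.eq_of_isIsomorphism {d : ℕ} (hd : 2 ≤ d) {o : SphereOrientation d} {n m : ℕ}
    {κ : Hom o n m} (h : IsIsomorphism κ) : n = m := by
  obtain ⟨_, K, rfl⟩ := κ
  obtain ⟨⟨_, L, rfl⟩, h1, h2⟩ := h
  exact le_antisymm
    (CobordismData.le_of_glue_equivalent_identity hd
      K.isCobordism.outgoing_embedding.continuous (Quotient.exact h1))
    (CobordismData.le_of_glue_equivalent_identity hd
      L.isCobordism.outgoing_embedding.continuous (Quotient.exact h2))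

/-! ### The relational model of `𝐊` -/

namespace Frob

/-- The interpretation of words as relations between lists: the Frobenius object is a two-element
set, whose operations are the relations between equal elements. -/
def Word.rel : Word → List Bool → List Bool → Prop
  | .one n, l, l' => l.length = n ∧ l = l'
  | .tau n m, l, l' => ∃ a b : List Bool, a.length = n ∧ b.length = m ∧ l = a ++ b ∧ l' = b ++ a
  | .mul, l, l' => ∃ x, l = [x, x] ∧ l' = [x]
  | .unit, l, l' => ∃ x, l = [] ∧ l' = [x]
  | .comul, l, l' => ∃ x, l = [x] ∧ l' = [x, x]
  | .counit, l, l' => ∃ x, l = [x] ∧ l' = []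
  | .comp g f, l, l' => ∃ k, f.rel l k ∧ g.rel k l'
  | .tensor f g, l, l' => ∃ a b a' b', f.rel a a' ∧ g.rel b b' ∧ l = a ++ b ∧ l' = a' ++ b'

/-- The model uses lists of arbitrary length, so typing survives only as this length condition. It
is what makes identities neutral and what allows a concatenation to be cut uniquely. -/
theorem HasType.length {f : Word} {n m : ℕ} (h : HasType f n m) :
    ∀ {l l' : List Bool}, f.rel l l' → l.length = n ∧ l'.length = m := by
  induction h with
  | one n => rintro l _ ⟨h, rfl⟩; exact ⟨h, h⟩
  | tau n m => rintro _ _ ⟨a, b, rfl, rfl, rfl, rfl⟩; simp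
  | mul => rintro _ _ ⟨x, rfl, rfl⟩; simp
  | unit => rintro _ _ ⟨x, rfl, rfl⟩; simp
  | comul => rintro _ _ ⟨x, rfl, rfl⟩; simp
  | counit => rintro _ _ ⟨x, rfl, rfl⟩; simp
  | comp _ _ ihf ihg => rintro _ _ ⟨k, hf, hg⟩; exact ⟨(ihf hf).1, (ihg hg).2⟩
  | tensor _ _ ihf ihg =>
    rintro _ _ ⟨a, b, a', b', hf, hg, rfl, rfl⟩
    simp [ihf hf, ihg hg]

/-- Soundness of the model. The strictness laws come from associativity of concatenation; for
interchange, naturality and the symmetry laws, two decompositions of one list are compared, and they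
coincide because their blocks have equal lengths. -/
theorem Equal.rel_eq {f g : Word} (h : Equal f g) : f.rel = g.rel := by
  induction h with
  | refl _ => rfl
  | symm _ ih => exact ih.symm
  | trans _ _ ih ih' => exact ih.trans ih'
  | comp_congr _ _ _ _ _ _ ih ih' => funext l l'; simp only [Word.rel, ih, ih']
  | tensor_congr _ _ ih ih' => funext l l'; simp only [Word.rel, ih, ih']
  | str_right _ => funext l l'; simp [Word.rel]
  | str_left _ => funext l l'; simp [Word.rel]
  | str_assoc _ _ _ =>
    funext l l'
    ext
    constructor
    · rintro ⟨_, c, _, c', ⟨a, b, a', b', h1, h2, rfl, rfl⟩, h3, rfl, rfl⟩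
      exact ⟨a, b ++ c, a', b' ++ c', h1, ⟨b, c, b', c', h2, h3, rfl, rfl⟩, by simp, by simp⟩
    · rintro ⟨a, _, a', _, h1, ⟨b, c, b', c', h2, h3, rfl, rfl⟩, rfl, rfl⟩
      exact ⟨a ++ b, c, a' ++ b', c', ⟨a, b, a', b', h1, h2, rfl, rfl⟩, h3, by simp, by simp⟩
  | cat_right hf =>
    funext l l'
    ext
    constructor
    · rintro ⟨_, ⟨-, rfl⟩, h⟩; exact h
    · exact fun h => ⟨l, ⟨(hf.length h).1, rfl⟩, h⟩
  | cat_left hf =>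
    funext l l'
    ext
    constructor
    · rintro ⟨_, h, -, rfl⟩; exact h
    · exact fun h => ⟨l', h, (hf.length h).2, rfl⟩
  | cat_assoc _ _ _ =>
    funext l l'
    ext
    constructor
    · rintro ⟨k, hf, k', hg, hh⟩; exact ⟨k', ⟨k, hf, hg⟩, hh⟩
    · rintro ⟨k', ⟨k, hf, hg⟩, hh⟩; exact ⟨k, hf, k', hg, hh⟩
  | fun_one n m =>
    funext l l'
    ext
    constructor
    · rintro ⟨a, b, _, _, ⟨rfl, rfl⟩, ⟨rfl, rfl⟩, rfl, rfl⟩; simp [Word.rel]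
    · rintro ⟨h, rfl⟩
      exact ⟨l.take n, l.drop n, _, _, ⟨by simp [h], rfl⟩, ⟨by simp [h], rfl⟩, by simp, by simp⟩
  | fun_comp hf₁ hg₁ hf₂ hg₂ =>
    funext l l'
    ext
    constructor
    · rintro ⟨a, b, a', b', ⟨k, h1, h2⟩, ⟨k', h3, h4⟩, rfl, rfl⟩
      exact ⟨k ++ k', ⟨_, _, _, _, h1, h3, rfl, rfl⟩, ⟨_, _, _, _, h2, h4, rfl, rfl⟩⟩
    · rintro ⟨_, ⟨a, b, a', b', h1, h2, rfl, rfl⟩, c, e, c', e', h3, h4, heq, rfl⟩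
      obtain ⟨rfl, rfl⟩ := List.append_inj heq ((hf₁.length h1).2.trans (hg₁.length h3).1.symm)
      exact ⟨a, b, c', e', ⟨_, h1, h3⟩, ⟨_, h2, h4⟩, rfl, rfl⟩
  | nat hf₁ hf₂ =>
    funext l l'
    ext
    constructor
    · rintro ⟨_, ⟨a, b, a', b', h1, h2, rfl, rfl⟩, c, e, hc, he, heq, rfl⟩
      obtain ⟨rfl, rfl⟩ := List.append_inj heq ((hf₁.length h1).2.trans hc.symm)
      exact ⟨b ++ a, ⟨a, b, (hf₁.length h1).1, (hf₂.length h2).1, rfl, rfl⟩,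
        b, a, _, _, h2, h1, rfl, rfl⟩
    · rintro ⟨_, ⟨a, b, ha, hb, rfl, rfl⟩, c, e, c', e', h2, h1, heq, rfl⟩
      obtain ⟨rfl, rfl⟩ := List.append_inj heq (hb.trans (hf₂.length h2).1.symm)
      exact ⟨e' ++ c', ⟨_, _, _, _, h1, h2, rfl, rfl⟩,
        e', c', (hf₁.length h1).2, (hf₂.length h2).2, rfl, rfl⟩
  | inv n m =>
    funext l l'
    ext
    constructor
    · rintro ⟨_, ⟨a, b, rfl, rfl, rfl, rfl⟩, c, e, hc, he, heq, rfl⟩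
      obtain ⟨rfl, rfl⟩ := List.append_inj heq hc.symm
      simp [Word.rel]
    · rintro ⟨h, rfl⟩
      exact ⟨l.drop n ++ l.take n, ⟨_, _, by simp [h], by simp [h], by simp, rfl⟩,
        _, _, by simp [h], by simp [h], rfl, by simp⟩
  | hex n m p =>
    funext l l'
    ext
    constructor
    · rintro ⟨a, b, ha, hb, rfl, rfl⟩
      -- With `a = a₁ ++ a₂` cut at `n`, the block `b` moves left in two stages: `a₁ a₂ b`, then `a₁
      -- b a₂`, then `b a₁ a₂`.
      refine ⟨a.take n ++ (b ++ a.drop n), ⟨a.take n, a.drop n ++ b, _, _, ⟨by simp [ha], rfl⟩,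
        ⟨a.drop n, b, by simp [ha], hb, rfl, rfl⟩, by simp [← List.append_assoc], rfl⟩,
        a.take n ++ b, a.drop n, b ++ a.take n, _, ⟨_, _, by simp [ha], hb, rfl, rfl⟩,
        ⟨by simp [ha], rfl⟩, by simp, by simp⟩
    · rintro ⟨_, ⟨a, _, _, _, ⟨ha, rfl⟩, ⟨b, c, hb, hc, rfl, rfl⟩, rfl, rfl⟩,
        _, e, _, _, ⟨a', c', ha', hc', rfl, rfl⟩, ⟨he, rfl⟩, heq, rfl⟩
      rw [← List.append_assoc] at heq
      -- The intermediate list is cut from the right first, since both last blocks have length `m`.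
      obtain ⟨h1, rfl⟩ := List.append_inj' heq (hb.trans he.symm)
      obtain ⟨rfl, rfl⟩ := List.append_inj h1 (ha.trans ha'.symm)
      exact ⟨a ++ b, c, by simp [ha, hb], hc, by simp, by simp⟩
  -- The Frobenius object axioms remain. All lists in them have explicit entries; in the Frobenius
  -- laws, for instance, each side just forces all entries to be equal.
  | _ =>
    funext l l'
    simp only [Word.rel, List.length_eq_one_iff, eq_iff_iff]
    aesop

/-- The interpretation of a word with a left inverse contains an injective function. -/
theorem two_pow_le_two_pow_of_retraction {n m : ℕ} {f g : Word} (hf : HasType f n m)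
    (h : Equal (g ∘' f) (.one n)) : 2 ^ n ≤ 2 ^ m := by
  have hgf : ∀ l : List.Vector Bool n, ∃ k : List.Vector Bool m, f.rel l.1 k.1 ∧ g.rel k.1 l.1 := by
    intro l
    have : (g ∘' f).rel l.1 l.1 := by rw [h.rel_eq]; exact ⟨l.2, rfl⟩
    obtain ⟨k, h1, h2⟩ := this
    exact ⟨⟨k, (hf.length h1).2⟩, h1, h2⟩
  choose φ hφ hφ' using hgf
  -- A common value `k` of `l` and `l'` links them through `l → k → l'`, and the composite relation
  -- is the identity.
  have hinj : Function.Injective φ := by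
    intro l l' e
    have : (g ∘' f).rel l.1 l'.1 := ⟨_, hφ l, e ▸ hφ' l'⟩
    rw [h.rel_eq] at this
    exact Subtype.ext this.2
  simpa using Fintype.card_le_of_injective φ hinj

theorem skeletal_kCat : Skeletal KCat := by
  rintro ⟨n⟩ ⟨m⟩ ⟨e⟩
  obtain ⟨f, hf⟩ := Quotient.exists_rep e.hom
  obtain ⟨g, hg⟩ := Quotient.exists_rep e.inv
  have h1 := e.hom_inv_id
  have h2 := e.inv_hom_id
  rw [← hf, ← hg] at h1 h2
  have e1 : Equal (g.1 ∘' f.1) (.one n) := Quotient.exact h1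
  have e2 : Equal (f.1 ∘' g.1) (.one m) := Quotient.exact h2
  -- A model with two elements suffices because the powers of 2 are distinct; a one-element model
  -- would not separate the objects.
  exact congrArg KCat.mk (Nat.pow_right_injective le_rfl (le_antisymm
    (two_pow_le_two_pow_of_retraction f.2 e1) (two_pow_le_two_pow_of_retraction g.2 e2)))

end Frob

theorem mainTheorem4 :
    (∀ (d : ℕ), 2 ≤ d → ∀ (o : SphereOrientation d),
      (∀ (n m : ℕ) (K : Cobordism o n m), DCobS.IsIsomorphism (DCobS.arrow K) → n = m) ∧
      DCobS.IsSkeletal o) ∧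
    CategoryTheory.Skeletal Frob.KCat := by

  refine ⟨fun d hd o => ⟨fun n m K h => DCobS.eq_of_isIsomorphism hd h, ?_⟩, Frob.skeletal_kCat⟩
  rintro n m ⟨κ, h⟩
  rw [DCobS.eq_of_isIsomorphism hd h]
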